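/- Let $q,\rho$ be real with $|q|<1$ and $|\rho|<1$, and let $x\in S(q)=\left[-\frac{2}{\sqrt{1-q}},\frac{2}{\sqrt{1-q}}\right]$. Write $[n]_q=1+q+\dots+q^{n-1}$, $[n]_q!=\prod_{j=1}^{n}[j]_q$, $(a)_\infty=\prod_{j=0}^{\infty}(1-aq^j)$ (with $0^0=1$), and $$L_k(x,\rho|q)=(1+\rho q^k)^2-(1-q)x^2\rho q^k .$$ Let $H_n(x|q)$ be the $q$-Hermite polynomials, defined by $H_0(x|q)=1$, $H_1(x|q)=x$ and $H_{n+1}(x|q)=xH_n(x|q)-[n]_qH_{n-1}(x|q)$ for $n\ge 1$. Then all the infinite products below converge, $(\rho)_\infty\neq 0$, every $[k]_q!$ and every $L_k(x,\rho|q)$ is nonzero, the series converges absolutely, and $$\sum_{k\ge 0}\frac{\rho^k\,(\rho q^{k+1})_\infty}{[k]_q!}\,H_{2k}(x|q)=\frac{(\rho^2)_\infty}{(\rho)_\infty}\prod_{k=0}^{\infty}L_k(x,\rho|q)^{-1}.$$ -/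

import Mathlib

open Finset

/-- The `q`-number `[n]_q = 1 + q + ⋯ + q ^ (n - 1)`, with `[0]_q = 0`. -/
def qNumber (q : ℝ) (n : ℕ) : ℝ := ∑ i ∈ range n, q ^ i

/-- The `q`-factorial `[n]_q! = [1]_q [2]_q ⋯ [n]_q`, with `[0]_q! = 1`. -/
def qFactorial (q : ℝ) (n : ℕ) : ℝ := ∏ j ∈ range n, qNumber q (j + 1)

/-- The infinite `q`-Pochhammer symbol `(a; q)_∞ = ∏_{j ≥ 0} (1 - a q ^ j)`. -/
noncomputable def qPochhammerInf (a q : ℝ) : ℝ := ∏' j : ℕ, (1 - a * q ^ j)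

/-- The set `S(q)`: the interval `[-2 / √(1 - q), 2 / √(1 - q)]` for `|q| < 1`,
and the whole line for `q = 1`. -/
noncomputable def qSupport (q : ℝ) : Set ℝ :=
  if |q| < 1 then Set.Icc (-(2 / √(1 - q))) (2 / √(1 - q)) else Set.univ

/-- The continuous `q`-Hermite polynomials `h_n(x|q)` in the normalization orthogonal on `[-1, 1]`:
`h_0 = 1`, `h_1 = 2 x`, `h_{n+1} = 2 x h_n - (1 - q ^ n) h_{n-1}`. -/
def qHermiteLower (q x : ℝ) : ℕ → ℝ
  | 0 => 1
  | 1 => 2 * x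
  | n + 2 => 2 * x * qHermiteLower q x (n + 1) - (1 - q ^ (n + 1)) * qHermiteLower q x n

/-- The `q`-Hermite polynomials `H_n(x|q)` in the normalization orthogonal on `S(q)`:
`H_0 = 1`, `H_1 = x`, `H_{n+1} = x H_n - [n]_q H_{n-1}`. -/
def qHermite (q x : ℝ) : ℕ → ℝ
  | 0 => 1
  | 1 => x
  | n + 2 => x * qHermite q x (n + 1) - qNumber q (n + 1) * qHermite q x n

/-- The two normalizations are related by
`H_n(x|q) = (1 - q) ^ (-n / 2) h_n(x √(1 - q) / 2 | q)`. -/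
theorem qHermite_eq_qHermiteLower {q : ℝ} (hq : q < 1) (x : ℝ) (n : ℕ) :
    qHermite q x n = qHermiteLower q (x * √(1 - q) / 2) n / √(1 - q) ^ n := by
  have h1 : 0 < 1 - q := by linarith
  have hs : √(1 - q) ≠ 0 := (Real.sqrt_pos.mpr h1).ne'
  have hsq : √(1 - q) ^ 2 = 1 - q := Real.sq_sqrt h1.le
  have key : ∀ m, qNumber q m * √(1 - q) ^ 2 = 1 - q ^ m := by
    intro m
    rw [hsq, qNumber, geom_sum_mul_neg]
  induction n using Nat.strong_induction_on with
  | _ n ih =>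
    match n with
    | 0 => simp [qHermite, qHermiteLower]
    | 1 =>
      simp only [qHermite, qHermiteLower]
      field_simp
    | n + 2 =>
      simp only [qHermite, qHermiteLower]
      rw [ih (n + 1) (by omega), ih n (by omega), ← key (n + 1)]
      field_simp
      ring

/-- The quadratic polynomials `L_k(x, a|q) = (1 + a q ^ k) ^ 2 - (1 - q) x ^ 2 a q ^ k`. For
`x = 2 cos θ / √(1 - q)` this is `(1 - a q ^ k exp (2 i θ)) (1 - a q ^ k exp (-2 i θ))`. -/
def qL (q x a : ℝ) (k : ℕ) : ℝ := (1 + a * q ^ k) ^ 2 - (1 - q) * x ^ 2 * a * q ^ k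

/-!
Write `F(a)` for the series of the theorem with `ρ = a`. Three-term recurrences of the
`q`-Hermite polynomials make `L₀(x, a) t_k(a) - (1 + a) (1 - q a²) t_k(a q)`, where `t_k(a)` is the
`k`-th term of `F(a)`, a telescoping difference. Hence
`L₀(x, a) F(a) = (1 + a) (1 - q a²) F(a q)`. After multiplication by `1 - a` the
factor on the right becomes `(1 - a²) (1 - a² q)`, so iterating along `a, a q, a q², …` and using
`F(b) → 1` as `b → 0` produces the three infinite products.

Convergence rests on the linear growth of `h_n` on `[-1, 1]`: for `X = cos θ`, `h_n(X|q) / (q; q)_n`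
is the `n`-th coefficient of `1 / ((z t; q)_∞ (w t; q)_∞)` with `z = exp (i θ)`, `w = exp (-i θ)`,
a sum of `n + 1` uniformly bounded terms.
-/

open Filter Topology

section InfiniteProduct

theorem mul_tprod_eq_tprod_of_tendsto_one {M : Type*} [CommMonoid M] [TopologicalSpace M]
    [ContinuousMul M] [T2Space M] {f g u : ℕ → M} (hf : Multipliable f) (hg : Multipliable g)
    (hu : Tendsto u atTop (𝓝 1)) (hfg : ∀ n, u n * f n = u (n + 1) * g n) :
    u 0 * ∏' n, f n = ∏' n, g n := by
  have partial_prod (n : ℕ) : u 0 * ∏ k ∈ range n, f k = u n * ∏ k ∈ range n, g k := by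
    induction n with
    | zero => simp only [range_zero, prod_empty]
    | succ n ih =>
      rw [prod_range_succ, ← mul_assoc, ih, mul_right_comm, hfg, prod_range_succ, mul_right_comm,
        mul_assoc]
  have left_limit := hf.hasProd.tendsto_prod_nat.const_mul (u 0)
  have right_limit := hu.mul hg.hasProd.tendsto_prod_nat
  rw [one_mul] at right_limit
  exact tendsto_nhds_unique left_limit (right_limit.congr fun n => (partial_prod n).symm)

theorem norm_tprod_one_add_sub_one_le {ι R : Type*} [NormedCommRing R] [NormOneClass R]
    [CompleteSpace R] {f : ι → R} (hf : Summable fun i => ‖f i‖) :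
    ‖∏' i, (1 + f i) - 1‖ ≤ Real.exp (∑' i, ‖f i‖) - 1 := by
  refine le_of_tendsto ((multipliable_one_add_of_summable hf).hasProd.sub_const 1).norm
    (Eventually.of_forall fun s => (s.norm_prod_one_add_sub_one_le f).trans ?_)
  gcongr
  exact hf.sum_le_tsum s fun i _ => norm_nonneg (f i)

end InfiniteProduct

section NormedField

variable {𝕜 : Type*} [NormedField 𝕜] {a q : 𝕜}

theorem summable_norm_neg_mul_pow (hq : ‖q‖ < 1) (a : 𝕜) :
    Summable fun j : ℕ => ‖-(a * q ^ j)‖ := by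
  simpa only [norm_neg, norm_mul, norm_pow] using
    (summable_geometric_of_lt_one (norm_nonneg q) hq).mul_left ‖a‖

theorem norm_mul_pow_lt_one (hq : ‖q‖ < 1) (ha : ‖a‖ < 1) (n : ℕ) : ‖a * q ^ n‖ < 1 := by
  rw [norm_mul, norm_pow]
  exact (mul_le_of_le_one_right (norm_nonneg a) (pow_le_one₀ (norm_nonneg q) hq.le)).trans_lt ha

theorem one_sub_mul_pow_ne_zero (hq : ‖q‖ < 1) (ha : ‖a‖ < 1) (n : ℕ) : 1 - a * q ^ n ≠ 0 :=
  fun h => by simpa [← sub_eq_zero.mp h] using norm_mul_pow_lt_one hq ha n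

variable [CompleteSpace 𝕜]

theorem multipliable_one_sub_mul_pow (hq : ‖q‖ < 1) (a : 𝕜) :
    Multipliable fun j : ℕ => 1 - a * q ^ j := by
  simpa only [sub_eq_add_neg] using
    multipliable_one_add_of_summable (summable_norm_neg_mul_pow hq a)

theorem tprod_one_sub_mul_pow_ne_zero (hq : ‖q‖ < 1) (ha : ‖a‖ < 1) :
    ∏' j : ℕ, (1 - a * q ^ j) ≠ 0 := by
  simpa only [sub_eq_add_neg] using tprod_one_add_ne_zero_of_summable
    (fun j => by simpa only [sub_eq_add_neg] using one_sub_mul_pow_ne_zero hq ha j)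
    (summable_norm_neg_mul_pow hq a)

end NormedField

section QPochhammer

/-- The finite `q`-Pochhammer symbol `(a; q)_n = ∏_{j < n} (1 - a q ^ j)`. -/
def qPochhammer {R : Type*} [CommRing R] (a q : R) (n : ℕ) : R := ∏ j ∈ range n, (1 - a * q ^ j)

theorem qPochhammer_succ {R : Type*} [CommRing R] (a q : R) (n : ℕ) :
    qPochhammer a q (n + 1) = qPochhammer a q n * (1 - a * q ^ n) :=
  prod_range_succ _ _

variable {𝕜 : Type*} [NormedField 𝕜] {a q : 𝕜}

theorem qPochhammer_ne_zero (hq : ‖q‖ < 1) (ha : ‖a‖ < 1) (n : ℕ) : qPochhammer a q n ≠ 0 :=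
  prod_ne_zero_iff.mpr fun j _ => one_sub_mul_pow_ne_zero hq ha j

variable [CompleteSpace 𝕜]

theorem tendsto_qPochhammer (hq : ‖q‖ < 1) (a : 𝕜) :
    Tendsto (qPochhammer a q) atTop (𝓝 (∏' j : ℕ, (1 - a * q ^ j))) :=
  (multipliable_one_sub_mul_pow hq a).hasProd.tendsto_prod_nat

theorem exists_norm_qPochhammer_le (hq : ‖q‖ < 1) (a : 𝕜) : ∃ C, ∀ n, ‖qPochhammer a q n‖ ≤ C := by
  simpa only [Set.forall_mem_range] using
    (Metric.isBounded_range_of_tendsto _ (tendsto_qPochhammer hq a)).exists_norm_le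

theorem exists_norm_inv_qPochhammer_le (hq : ‖q‖ < 1) (ha : ‖a‖ < 1) :
    ∃ C, ∀ n, ‖(qPochhammer a q n)⁻¹‖ ≤ C := by
  simpa only [Set.forall_mem_range] using (Metric.isBounded_range_of_tendsto _
    ((tendsto_qPochhammer hq a).inv₀ (tprod_one_sub_mul_pow_ne_zero hq ha))).exists_norm_le

end QPochhammer

section QPochhammerInf

variable {a q : ℝ}

theorem qPochhammerInf_ne_zero (hq : |q| < 1) (ha : |a| < 1) : qPochhammerInf a q ≠ 0 :=
  tprod_one_sub_mul_pow_ne_zero hq ha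

theorem qPochhammerInf_eq_one_sub_mul (hq : |q| < 1) (a : ℝ) :
    qPochhammerInf a q = (1 - a) * qPochhammerInf (a * q) q := by
  have shifted : (fun j : ℕ => 1 - a * q ^ (j + 1)) = fun j => 1 - a * q * q ^ j := by
    ext j
    ring
  rw [qPochhammerInf, tprod_eq_zero_mul' (shifted ▸ multipliable_one_sub_mul_pow hq (a * q)),
    shifted, pow_zero, mul_one, qPochhammerInf]

theorem qPochhammerInf_mul_pow (hq : |q| < 1) (a : ℝ) (n : ℕ) :
    qPochhammerInf (a * q ^ n) q = (1 - a * q ^ n) * qPochhammerInf (a * q ^ (n + 1)) q := by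
  rw [qPochhammerInf_eq_one_sub_mul hq, mul_assoc, ← pow_succ]

theorem abs_qPochhammerInf_sub_one_le (hq : |q| < 1) (a : ℝ) :
    |qPochhammerInf a q - 1| ≤ Real.exp (|a| / (1 - |q|)) - 1 := by
  have norm_sum : ∑' j : ℕ, ‖-(a * q ^ j)‖ = |a| / (1 - |q|) := by
    simp only [norm_neg, norm_mul, norm_pow, Real.norm_eq_abs, tsum_mul_left,
      tsum_geometric_of_lt_one (abs_nonneg q) hq, div_eq_mul_inv]
  rw [← norm_sum, ← Real.norm_eq_abs]
  simpa only [qPochhammerInf, ← sub_eq_add_neg] using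
    norm_tprod_one_add_sub_one_le (summable_norm_neg_mul_pow hq a)

theorem abs_qPochhammerInf_le (hq : |q| < 1) (ha : |a| ≤ 1) :
    |qPochhammerInf a q| ≤ Real.exp (1 / (1 - |q|)) := by
  calc |qPochhammerInf a q| ≤ |qPochhammerInf a q - 1| + 1 := by
        simpa using abs_add_le (qPochhammerInf a q - 1) 1
    _ ≤ Real.exp (|a| / (1 - |q|)) := by linarith [abs_qPochhammerInf_sub_one_le hq a]
    _ ≤ Real.exp (1 / (1 - |q|)) :=
        Real.exp_le_exp.mpr (div_le_div_of_nonneg_right ha (sub_nonneg.mpr hq.le))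

theorem tendsto_qPochhammerInf_nhds_zero (hq : |q| < 1) :
    Tendsto (fun a => qPochhammerInf a q) (𝓝 0) (𝓝 1) := by
  have bound : Tendsto (fun a : ℝ => Real.exp (|a| / (1 - |q|)) - 1) (𝓝 0) (𝓝 0) :=
    (by fun_prop : Continuous fun a : ℝ => Real.exp (|a| / (1 - |q|)) - 1).tendsto' _ _ (by simp)
  exact tendsto_sub_nhds_zero_iff.mp
    (squeeze_zero_norm (abs_qPochhammerInf_sub_one_le hq) bound)

theorem abs_mul_pow_lt_one (hq : |q| < 1) (ha : |a| < 1) (n : ℕ) : |a * q ^ n| < 1 := by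
  simpa only [Real.norm_eq_abs] using norm_mul_pow_lt_one (𝕜 := ℝ) hq ha n

theorem tendsto_mul_pow_zero (hq : |q| < 1) (a : ℝ) :
    Tendsto (fun n : ℕ => a * q ^ n) atTop (𝓝 0) := by
  simpa only [mul_zero] using (tendsto_pow_atTop_nhds_zero_of_abs_lt_one hq).const_mul a

theorem hasProd_even_mul_odd_factors (hq : |q| < 1) (a : ℝ) :
    HasProd (fun n : ℕ => (1 - a * q ^ (2 * n)) * (1 - a * q ^ (2 * n + 1)))
      (qPochhammerInf a q) := by
  have hq_sq : ‖q ^ 2‖ < 1 := by simpa using hq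
  have even : Multipliable fun n : ℕ => 1 - a * q ^ (2 * n) := by
    simpa only [pow_mul] using multipliable_one_sub_mul_pow hq_sq a
  have odd : Multipliable fun n : ℕ => 1 - a * q ^ (2 * n + 1) := by
    simpa only [pow_mul, pow_succ', mul_assoc] using multipliable_one_sub_mul_pow hq_sq (a * q)
  rw [qPochhammerInf, ← tprod_even_mul_odd (f := fun j => 1 - a * q ^ j) even odd]
  exact even.hasProd.mul odd.hasProd

end QPochhammerInf

section QFactorial

variable {q : ℝ}

theorem one_sub_mul_qNumber (q : ℝ) (n : ℕ) : (1 - q) * qNumber q n = 1 - q ^ n := by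
  rw [qNumber, mul_comm, geom_sum_mul_neg]

theorem qFactorial_succ (q : ℝ) (n : ℕ) :
    qFactorial q (n + 1) = qFactorial q n * qNumber q (n + 1) :=
  prod_range_succ _ _

theorem one_sub_pow_mul_qFactorial (q : ℝ) (n : ℕ) :
    (1 - q) ^ n * qFactorial q n = qPochhammer q q n := by
  rw [qFactorial, qPochhammer, pow_eq_prod_const, ← prod_mul_distrib]
  simp only [one_sub_mul_qNumber, pow_succ']

theorem qFactorial_ne_zero (hq : |q| < 1) (n : ℕ) : qFactorial q n ≠ 0 :=
  right_ne_zero_of_mul (one_sub_pow_mul_qFactorial q n ▸ qPochhammer_ne_zero hq hq n)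

end QFactorial

section RogersSzego

variable {K : Type*} [Field K] {q : K}

/-- The coefficient of `t ^ n` in `1 / ((z t; q)_∞ (w t; q)_∞)`, that is, the homogeneous
Rogers–Szegő polynomial in `z` and `w` divided by `(q; q)_n`. It expresses `h_n(X|q)` through the
roots `z`, `w` of `t² - 2 X t + 1`. -/
def rogersSzegoCoeff (q z w : K) (n : ℕ) : K :=
  ∑ p ∈ antidiagonal n, z ^ p.1 / qPochhammer q q p.1 * (w ^ p.2 / qPochhammer q q p.2)

theorem one_sub_pow_mul_pow_div_qPochhammer (hq : ∀ n : ℕ, 1 - q * q ^ n ≠ 0) (z : K) (n : ℕ) :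
    (1 - q ^ (n + 1)) * (z ^ (n + 1) / qPochhammer q q (n + 1)) =
      z * (z ^ n / qPochhammer q q n) := by
  rw [qPochhammer_succ, pow_succ' q]
  have := hq n
  field_simp
  ring

theorem sum_antidiagonal_one_sub_pow_mul (hq : ∀ n : ℕ, 1 - q * q ^ n ≠ 0) (z : K) (d : ℕ → K)
    (n : ℕ) :
    ∑ p ∈ antidiagonal (n + 1), (1 - q ^ p.1) * (z ^ p.1 / qPochhammer q q p.1) * d p.2 =
      z * ∑ p ∈ antidiagonal n, z ^ p.1 / qPochhammer q q p.1 * d p.2 := by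
  rw [Nat.sum_antidiagonal_succ, mul_sum]
  simp only [one_sub_pow_mul_pow_div_qPochhammer hq, pow_zero, sub_self, zero_mul, zero_add,
    ← mul_assoc]

theorem sum_antidiagonal_mul_one_sub_pow (hq : ∀ n : ℕ, 1 - q * q ^ n ≠ 0) (w : K) (c : ℕ → K)
    (n : ℕ) :
    ∑ p ∈ antidiagonal (n + 1), c p.1 * ((1 - q ^ p.2) * (w ^ p.2 / qPochhammer q q p.2)) =
      w * ∑ p ∈ antidiagonal n, c p.1 * (w ^ p.2 / qPochhammer q q p.2) := by
  simp only [Nat.sum_antidiagonal_succ', one_sub_pow_mul_pow_div_qPochhammer hq, pow_zero, sub_self,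
    zero_mul, mul_zero, zero_add, mul_sum, mul_left_comm]

theorem rogersSzegoCoeff_zero (q z w : K) : rogersSzegoCoeff q z w 0 = 1 := by
  simp [rogersSzegoCoeff, qPochhammer]

theorem one_sub_mul_rogersSzegoCoeff_one (hq : 1 - q ≠ 0) (z w : K) :
    (1 - q) * rogersSzegoCoeff q z w 1 = z + w := by
  simp only [rogersSzegoCoeff, qPochhammer, Nat.sum_antidiagonal_succ, Nat.antidiagonal_zero,
    sum_singleton, prod_range_zero, prod_range_one, zero_add, pow_zero, pow_one, mul_one, div_one]
  field_simp
  ring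

theorem one_sub_pow_mul_rogersSzegoCoeff (hq : ∀ n : ℕ, 1 - q * q ^ n ≠ 0) (z w : K) (n : ℕ) :
    (1 - q ^ (n + 2)) * rogersSzegoCoeff q z w (n + 2) =
      (z + w) * rogersSzegoCoeff q z w (n + 1) - z * w * rogersSzegoCoeff q z w n := by
  -- `1 - q ^ (i + j) = (1 - q ^ i) + (1 - q ^ j) - (1 - q ^ i) (1 - q ^ j)`
  let c (i : ℕ) : K := z ^ i / qPochhammer q q i
  let d (j : ℕ) : K := w ^ j / qPochhammer q q j
  have split : (1 - q ^ (n + 2)) * rogersSzegoCoeff q z w (n + 2) =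
      ∑ p ∈ antidiagonal (n + 2), (1 - q ^ p.1) * c p.1 * d p.2 +
      ∑ p ∈ antidiagonal (n + 2), c p.1 * ((1 - q ^ p.2) * d p.2) -
      ∑ p ∈ antidiagonal (n + 2), (1 - q ^ p.1) * c p.1 * ((1 - q ^ p.2) * d p.2) := by
    rw [rogersSzegoCoeff, mul_sum, ← sum_add_distrib, ← sum_sub_distrib]
    refine sum_congr rfl fun p hp => ?_
    rw [← mem_antidiagonal.mp hp, pow_add]
    ring
  rw [split, sum_antidiagonal_one_sub_pow_mul hq z d,
    sum_antidiagonal_mul_one_sub_pow hq w c,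
    sum_antidiagonal_one_sub_pow_mul hq z fun j => (1 - q ^ j) * d j,
    sum_antidiagonal_mul_one_sub_pow hq w c]
  simp only [rogersSzegoCoeff, c, d]
  ring

end RogersSzego

theorem exists_norm_rogersSzegoCoeff_le {𝕜 : Type*} [NormedField 𝕜] [CompleteSpace 𝕜] {q : 𝕜}
    (hq : ‖q‖ < 1) :
    ∃ C, ∀ z w : 𝕜, ‖z‖ ≤ 1 → ‖w‖ ≤ 1 → ∀ n : ℕ, ‖rogersSzegoCoeff q z w n‖ ≤ C * (n + 1) := by
  obtain ⟨D, hD⟩ := exists_norm_inv_qPochhammer_le hq hq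
  have factor_le {z : 𝕜} (hz : ‖z‖ ≤ 1) (n : ℕ) : ‖z ^ n / qPochhammer q q n‖ ≤ D := by
    rw [div_eq_mul_inv, norm_mul, norm_pow]
    exact (mul_le_of_le_one_left (norm_nonneg _) (pow_le_one₀ (norm_nonneg z) hz)).trans (hD n)
  refine ⟨D * D, fun z w hz hw n => ?_⟩
  calc ‖rogersSzegoCoeff q z w n‖ ≤ ∑ _p ∈ antidiagonal n, D * D :=
        norm_sum_le_of_le _ fun p _ => norm_mul_le_of_le (factor_le hz p.1) (factor_le hw p.2)
    _ = D * D * (n + 1) := by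
        rw [sum_const, Nat.card_antidiagonal, nsmul_eq_mul, mul_comm, Nat.cast_succ]

section Growth

variable {q x X : ℝ}

theorem exists_norm_eq_one_mul_eq_one_add_eq_two_mul (hX : |X| ≤ 1) :
    ∃ z w : ℂ, ‖z‖ = 1 ∧ ‖w‖ = 1 ∧ z * w = 1 ∧ z + w = 2 * X := by
  refine ⟨Complex.exp (Real.arccos X * Complex.I), Complex.exp (-Real.arccos X * Complex.I),
    Complex.norm_exp_ofReal_mul_I _, ?_, ?_, ?_⟩
  · simpa using Complex.norm_exp_ofReal_mul_I (-Real.arccos X)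
  · rw [← Complex.exp_add, neg_mul, add_neg_cancel, Complex.exp_zero]
  · rw [← Complex.two_cos, ← Complex.ofReal_cos,
      Real.cos_arccos (abs_le.mp hX).1 (abs_le.mp hX).2]

theorem ofReal_qHermiteLower_eq_qPochhammer_mul (hq : |q| < 1) {z w : ℂ} (hzw : z * w = 1)
    (hX : z + w = 2 * X) (n : ℕ) :
    (qHermiteLower q X n : ℂ) = qPochhammer (q : ℂ) q n * rogersSzegoCoeff (q : ℂ) z w n := by
  have hq' : ‖(q : ℂ)‖ < 1 := by rwa [Complex.norm_real]
  have factor_ne_zero := one_sub_mul_pow_ne_zero hq' hq'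
  induction n using Nat.twoStepInduction with
  | zero => simp [qHermiteLower, qPochhammer, rogersSzegoCoeff_zero]
  | one =>
    have recurrence := one_sub_mul_rogersSzegoCoeff_one (by simpa using factor_ne_zero 0) z w
    simp [qHermiteLower, qPochhammer, recurrence, hX]
  | more n ih₀ ih₁ =>
    have recurrence := one_sub_pow_mul_rogersSzegoCoeff factor_ne_zero z w n
    rw [hzw, hX] at recurrence
    rw [qHermiteLower, qPochhammer_succ, qPochhammer_succ]
    rw [qPochhammer_succ] at ih₁
    push_cast
    rw [ih₀, ih₁]
    linear_combination
      -(qPochhammer (q : ℂ) q n * (1 - (q : ℂ) * q ^ n)) * recurrence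

theorem exists_abs_qHermiteLower_le (hq : |q| < 1) (hX : |X| ≤ 1) :
    ∃ C, ∀ n : ℕ, |qHermiteLower q X n| ≤ C * (n + 1) := by
  have hq' : ‖(q : ℂ)‖ < 1 := by rwa [Complex.norm_real]
  obtain ⟨z, w, hz, hw, hzw, hzwX⟩ := exists_norm_eq_one_mul_eq_one_add_eq_two_mul hX
  obtain ⟨B, hB⟩ := exists_norm_qPochhammer_le hq' (q : ℂ)
  obtain ⟨C, hC⟩ := exists_norm_rogersSzegoCoeff_le hq'
  refine ⟨B * C, fun n => ?_⟩
  rw [← Real.norm_eq_abs, ← Complex.norm_real,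
    ofReal_qHermiteLower_eq_qPochhammer_mul hq hzw hzwX, mul_assoc]
  exact norm_mul_le_of_le (hB n) (hC z w hz.le hw.le n)

theorem sq_le_of_mem_qSupport (hq : |q| < 1) (hx : x ∈ qSupport q) : (1 - q) * x ^ 2 ≤ 4 := by
  have hq' : 0 < 1 - q := sub_pos.mpr (abs_lt.mp hq).2
  rw [qSupport, if_pos hq, Set.mem_Icc, ← abs_le, le_div_iff₀ (Real.sqrt_pos.mpr hq')] at hx
  have squared := pow_le_pow_left₀ (by positivity) hx 2
  rw [mul_pow, sq_abs, Real.sq_sqrt hq'.le] at squared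
  linarith

theorem abs_mul_sqrt_div_two_le_one (hq : |q| < 1) (hx : x ∈ qSupport q) :
    |x * √(1 - q) / 2| ≤ 1 := by
  have hq' : 0 ≤ 1 - q := sub_nonneg.mpr (abs_lt.mp hq).2.le
  rw [← sq_le_one_iff_abs_le_one, div_pow, mul_pow, Real.sq_sqrt hq']
  linarith [sq_le_of_mem_qSupport hq hx]

theorem exists_abs_qHermite_div_qFactorial_le (hq : |q| < 1) (hx : x ∈ qSupport q) (i : ℕ) :
    ∃ C, ∀ k : ℕ, |qHermite q x (2 * k + i) / qFactorial q k| ≤ C * (2 * k + i + 1) := by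
  have hq' : 0 < 1 - q := sub_pos.mpr (abs_lt.mp hq).2
  obtain ⟨B, hB⟩ := exists_abs_qHermiteLower_le hq (abs_mul_sqrt_div_two_le_one hq hx)
  obtain ⟨D, hD⟩ := exists_norm_inv_qPochhammer_le (Real.norm_eq_abs q ▸ hq) hq
  refine ⟨B * D / √(1 - q) ^ i, fun k => ?_⟩
  have rescaled : qHermite q x (2 * k + i) / qFactorial q k =
      qHermiteLower q (x * √(1 - q) / 2) (2 * k + i) * (qPochhammer q q k)⁻¹ / √(1 - q) ^ i := by
    rw [qHermite_eq_qHermiteLower (abs_lt.mp hq).2, ← one_sub_pow_mul_qFactorial, pow_add,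
      pow_mul, Real.sq_sqrt hq'.le]
    field_simp
  have lower_le := hB (2 * k + i)
  push_cast at lower_le
  rw [rescaled, abs_div, abs_of_nonneg (by positivity : 0 ≤ √(1 - q) ^ i), div_mul_eq_mul_div]
  gcongr
  exact (norm_mul_le_of_le lower_le (hD k)).trans_eq (by ring)

theorem summable_abs_pow_mul_qHermite_div_qFactorial (hq : |q| < 1) (hx : x ∈ qSupport q) {r : ℝ}
    (hr : |r| < 1) (i : ℕ) :
    Summable fun k : ℕ => |r ^ k * (qHermite q x (2 * k + i) / qFactorial q k)| := by
  obtain ⟨C, hC⟩ := exists_abs_qHermite_div_qFactorial_le hq hx i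
  have hr' : ‖|r|‖ < 1 := by rwa [Real.norm_eq_abs, abs_abs]
  have linear : Summable fun k : ℕ => |r| ^ k * (C * (2 * k + i + 1)) :=
    (((summable_pow_mul_geometric_of_norm_lt_one 1 hr').mul_left (2 * C)).add
      ((summable_geometric_of_norm_lt_one hr').mul_left (C * (i + 1)))).congr fun k => by ring
  refine linear.of_nonneg_of_le (fun k => abs_nonneg _) fun k => ?_
  rw [abs_mul, abs_pow]
  gcongr
  exact hC k

theorem tendsto_pow_mul_qHermite_div_qFactorial (hq : |q| < 1) (hx : x ∈ qSupport q) {r : ℝ}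
    (hr : |r| < 1) (i : ℕ) :
    Tendsto (fun k : ℕ => r ^ k * (qHermite q x (2 * k + i) / qFactorial q k)) atTop (𝓝 0) :=
  (summable_abs_iff.mp
    (summable_abs_pow_mul_qHermite_div_qFactorial hq hx hr i)).tendsto_atTop_zero

end Growth

section QuadraticFactor

variable {a q x : ℝ}

theorem qL_mul_pow_zero (q x a : ℝ) (n : ℕ) : qL q x (a * q ^ n) 0 = qL q x a n := by
  simp only [qL, pow_zero, mul_one, mul_assoc]

theorem qL_pos (hq : |q| < 1) (ha : |a| < 1) (hx : x ∈ qSupport q) (k : ℕ) : 0 < qL q x a k := by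
  have hq' : 0 ≤ 1 - q := sub_nonneg.mpr (abs_lt.mp hq).2.le
  obtain ⟨lower, upper⟩ := abs_lt.mp (abs_mul_pow_lt_one hq ha k)
  set b := a * q ^ k
  set s := (1 - q) * x ^ 2 / 4
  have hs₀ : 0 ≤ s := by positivity
  have hs₁ : s ≤ 1 := (div_le_one four_pos).mpr (sq_le_of_mem_qSupport hq hx)
  have convex_combination : qL q x a k = (1 - s) * (1 + b) ^ 2 + s * (1 - b) ^ 2 := by
    simp only [qL, s, b]
    ring
  have plus : 0 < (1 + b) ^ 2 := pow_pos (by linarith) 2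
  have minus : 0 < (1 - b) ^ 2 := pow_pos (by linarith) 2
  rw [convex_combination]
  exact convex_Ioi (𝕜 := ℝ) (0 : ℝ) plus minus (sub_nonneg.mpr hs₁) hs₀ (sub_add_cancel 1 s)

theorem summable_norm_qL_sub_one (hq : |q| < 1) (x a : ℝ) :
    Summable fun k : ℕ => ‖qL q x a k - 1‖ := by
  have hq_sq : |q ^ 2| < 1 := by simpa using hq
  refine ((((summable_geometric_of_abs_lt_one hq).mul_left ((2 - (1 - q) * x ^ 2) * a)).add
    ((summable_geometric_of_abs_lt_one hq_sq).mul_left (a ^ 2))).congr fun k => ?_).norm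
  rw [qL]
  ring

theorem multipliable_qL (hq : |q| < 1) (x a : ℝ) : Multipliable fun k : ℕ => qL q x a k := by
  simpa only [add_sub_cancel] using
    multipliable_one_add_of_summable (summable_norm_qL_sub_one hq x a)

theorem tprod_qL_ne_zero (hq : |q| < 1) (ha : |a| < 1) (hx : x ∈ qSupport q) :
    ∏' k : ℕ, qL q x a k ≠ 0 := by
  simpa only [add_sub_cancel] using tprod_one_add_ne_zero_of_summable
    (fun k => by simpa only [add_sub_cancel] using (qL_pos hq ha hx k).ne')
    (summable_norm_qL_sub_one hq x a)

end QuadraticFactor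

section EvenHermite

variable {a q x : ℝ}

/-- The term `t_k(a) = a ^ k (a q ^ (k + 1); q)_∞ H_{2k}(x|q) / [k]_q!` of the expansion. -/
noncomputable def evenHermiteTerm (q x a : ℝ) (k : ℕ) : ℝ :=
  a ^ k * qPochhammerInf (a * q ^ (k + 1)) q / qFactorial q k * qHermite q x (2 * k)

/-- The antidifference in `k` of `L_0(x, a|q) t_k(a) - (1 + a) (1 - q a ^ 2) t_k(a q)`, which makes
the series telescope. The coefficient of `a (a q ^ (k + 1); q)_∞` is
`(1 - q ^ (2k)) [2k - 1]_q H_{2k - 2}(x|q)`, written without negative indices. -/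
noncomputable def evenHermiteAntidifference (q x a : ℝ) (k : ℕ) : ℝ :=
  a ^ k / qFactorial q k *
    (a * qPochhammerInf (a * q ^ (k + 1)) q *
        (((1 - q) * x ^ 2 - (1 - q ^ (2 * k))) * qHermite q x (2 * k) -
          (1 - q) * x * qHermite q x (2 * k + 1)) -
      (1 - q ^ k) * qPochhammerInf (a * q ^ k) q * qHermite q x (2 * k))

theorem abs_evenHermiteTerm_le (hq : |q| < 1) {r : ℝ} (hr : r ≤ 1) (har : |a| ≤ r) (k : ℕ) :
    |evenHermiteTerm q x a k| ≤
      Real.exp (1 / (1 - |q|)) * |r ^ k * (qHermite q x (2 * k) / qFactorial q k)| := by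
  have shift_le : |a * q ^ (k + 1)| ≤ 1 := by
    rw [abs_mul, abs_pow]
    exact mul_le_one₀ (har.trans hr) (by positivity) (pow_le_one₀ (abs_nonneg q) hq.le)
  have split : evenHermiteTerm q x a k = qPochhammerInf (a * q ^ (k + 1)) q *
      (a ^ k * (qHermite q x (2 * k) / qFactorial q k)) := by
    rw [evenHermiteTerm]
    ring
  rw [split, abs_mul, abs_mul (a ^ k), abs_mul (r ^ k), abs_pow, abs_pow]
  have base_le : |a| ≤ |r| := har.trans (le_abs_self r)
  gcongr
  exact abs_qPochhammerInf_le hq shift_le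

theorem summable_evenHermiteTerm (hq : |q| < 1) (hx : x ∈ qSupport q) (ha : |a| < 1) :
    Summable (evenHermiteTerm q x a) :=
  .of_norm_bounded ((summable_abs_pow_mul_qHermite_div_qFactorial hq hx
    (by rwa [abs_abs] : |(|a|)| < 1) 0).mul_left _) (abs_evenHermiteTerm_le hq ha.le le_rfl)

theorem tendsto_tsum_evenHermiteTerm_nhds_zero (hq : |q| < 1) (hx : x ∈ qSupport q) :
    Tendsto (fun a => ∑' k, evenHermiteTerm q x a k) (𝓝 0) (𝓝 1) := by
  have limit_sum : ∑' k : ℕ, (0 : ℝ) ^ k * 1 / qFactorial q k * qHermite q x (2 * k) = 1 := by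
    rw [tsum_eq_single 0 fun k hk => by simp [hk]]
    simp [qFactorial, qHermite]
  have half_lt_one : |(1 / 2 : ℝ)| < 1 := by norm_num [abs_lt]
  rw [← limit_sum]
  refine tendsto_tsum_of_dominated_convergence
    ((summable_abs_pow_mul_qHermite_div_qFactorial hq hx half_lt_one 0).mul_left
      (Real.exp (1 / (1 - |q|)))) (fun k => ?_) ?_
  · have shift : Tendsto (fun a : ℝ => a * q ^ (k + 1)) (𝓝 0) (𝓝 0) :=
      (continuous_mul_const _).tendsto' _ _ (zero_mul _)
    exact (((tendsto_id.pow k).mul ((tendsto_qPochhammerInf_nhds_zero hq).comp shift)).div_const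
      _).mul_const _
  · filter_upwards [Metric.closedBall_mem_nhds (0 : ℝ) one_half_pos] with a ha
    exact abs_evenHermiteTerm_le hq one_half_lt_one.le (by simpa using ha)

theorem evenHermiteAntidifference_zero (q x a : ℝ) : evenHermiteAntidifference q x a 0 = 0 := by
  simp only [evenHermiteAntidifference, mul_zero, zero_add, pow_zero, qHermite]
  ring

theorem tendsto_evenHermiteAntidifference (hq : |q| < 1) (hx : x ∈ qSupport q) (ha : |a| < 1) :
    Tendsto (evenHermiteAntidifference q x a) atTop (𝓝 0) := by
  have even := tendsto_pow_mul_qHermite_div_qFactorial hq hx ha 0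
  have odd := tendsto_pow_mul_qHermite_div_qFactorial hq hx ha 1
  have pow_q := tendsto_pow_atTop_nhds_zero_of_abs_lt_one hq
  have pow_q_even := pow_q.comp (tendsto_id.const_mul_atTop' (two_pos : 0 < 2))
  have pochhammer := (tendsto_qPochhammerInf_nhds_zero hq).comp (tendsto_mul_pow_zero hq a)
  have pochhammer_succ := pochhammer.comp (tendsto_add_atTop_nat 1)
  have combined := ((pochhammer_succ.const_mul a).mul
    (((pow_q_even.const_sub 1).const_sub ((1 - q) * x ^ 2)).mul even |>.sub
      (odd.const_mul ((1 - q) * x)))).sub (((pow_q.const_sub 1).mul pochhammer).mul even)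
  simp only [mul_zero, sub_zero] at combined
  refine combined.congr fun k => ?_
  simp only [evenHermiteAntidifference, Function.comp_apply, id_eq, add_zero]
  ring

theorem qL_mul_evenHermiteTerm_sub (hq : |q| < 1) (x a : ℝ) (k : ℕ) :
    qL q x a 0 * evenHermiteTerm q x a k -
        (1 + a) * (1 - q * a ^ 2) * evenHermiteTerm q x (a * q) k =
      evenHermiteAntidifference q x a (k + 1) - evenHermiteAntidifference q x a k := by
  have hq' : 1 - q ≠ 0 := (sub_pos.mpr (abs_lt.mp hq).2).ne'
  have next_ne_zero : 1 - q * q ^ k ≠ 0 := one_sub_mul_pow_ne_zero hq hq k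
  have factorial_ne_zero := qFactorial_ne_zero hq k
  have number (n : ℕ) : qNumber q n = (1 - q ^ n) / (1 - q) := by
    rw [← one_sub_mul_qNumber, mul_div_cancel_left₀ _ hq']
  have hermite_even : qHermite q x (2 * (k + 1)) =
      x * qHermite q x (2 * k + 1) - qNumber q (2 * k + 1) * qHermite q x (2 * k) := rfl
  have hermite_odd : qHermite q x (2 * (k + 1) + 1) =
      x * qHermite q x (2 * (k + 1)) - qNumber q (2 * k + 2) * qHermite q x (2 * k + 1) := rfl
  have pochhammer : qPochhammerInf (a * q ^ k) q = (1 - a * q ^ k) *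
      ((1 - a * q ^ (k + 1)) * qPochhammerInf (a * q ^ (k + 2)) q) := by
    rw [qPochhammerInf_mul_pow hq, qPochhammerInf_mul_pow hq]
  have shift : a * q * q ^ (k + 1) = a * q ^ (k + 2) := by ring
  simp only [evenHermiteTerm, evenHermiteAntidifference, hermite_odd, hermite_even, shift,
    qFactorial_succ, number, pochhammer, qPochhammerInf_mul_pow hq a (k + 1), add_assoc,
    Nat.reduceAdd]
  generalize qPochhammerInf (a * q ^ (k + 2)) q = A
  simp only [qL, mul_pow, mul_add_one, pow_add, pow_mul', pow_zero, pow_one]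
  generalize q ^ k = t at *
  field_simp
  ring

theorem qL_mul_tsum_evenHermiteTerm (hq : |q| < 1) (hx : x ∈ qSupport q) (ha : |a| < 1) :
    qL q x a 0 * ∑' k, evenHermiteTerm q x a k =
      (1 + a) * (1 - q * a ^ 2) * ∑' k, evenHermiteTerm q x (a * q) k := by
  have haq : |a * q| < 1 := by simpa only [pow_one] using abs_mul_pow_lt_one hq ha 1
  have difference := ((summable_evenHermiteTerm hq hx ha).hasSum.mul_left (qL q x a 0)).sub
    ((summable_evenHermiteTerm hq hx haq).hasSum.mul_left ((1 + a) * (1 - q * a ^ 2)))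
  refine sub_eq_zero.mp (tendsto_nhds_unique difference.tendsto_sum_nat
    ((tendsto_evenHermiteAntidifference hq hx ha).congr fun n => ?_))
  simp only [qL_mul_evenHermiteTerm_sub hq, sum_range_sub, evenHermiteAntidifference_zero,
    sub_zero]

theorem tsum_evenHermiteTerm_mul_tprod_qL (hq : |q| < 1) (hx : x ∈ qSupport q) (ha : |a| < 1) :
    (∑' k, evenHermiteTerm q x a k) * (qPochhammerInf a q * ∏' k, qL q x a k) =
      qPochhammerInf (a ^ 2) q := by
  have limit := (tendsto_tsum_evenHermiteTerm_nhds_zero hq hx).comp (tendsto_mul_pow_zero hq a)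
  have recurrence (n : ℕ) :
      (∑' k, evenHermiteTerm q x (a * q ^ n) k) * ((1 - a * q ^ n) * qL q x a n) =
        (∑' k, evenHermiteTerm q x (a * q ^ (n + 1)) k) *
          ((1 - a ^ 2 * q ^ (2 * n)) * (1 - a ^ 2 * q ^ (2 * n + 1))) := by
    have step := qL_mul_tsum_evenHermiteTerm hq hx (abs_mul_pow_lt_one hq ha n)
    rw [qL_mul_pow_zero, mul_assoc a, ← pow_succ] at step
    linear_combination (1 - a * q ^ n) * step
  have iterated := mul_tprod_eq_tprod_of_tendsto_one
    ((multipliable_one_sub_mul_pow hq a).mul (multipliable_qL hq x a))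
    (hasProd_even_mul_odd_factors hq (a ^ 2)).multipliable limit recurrence
  rwa [Function.comp_apply, pow_zero, mul_one, (hasProd_even_mul_odd_factors hq _).tprod_eq,
    (multipliable_one_sub_mul_pow hq a).tprod_mul (multipliable_qL hq x a)] at iterated

theorem tsum_evenHermiteTerm (hq : |q| < 1) (hx : x ∈ qSupport q) (ha : |a| < 1) :
    ∑' k, evenHermiteTerm q x a k =
      qPochhammerInf (a ^ 2) q / qPochhammerInf a q * ∏' k, (qL q x a k)⁻¹ := by
  have pochhammer_ne_zero := qPochhammerInf_ne_zero hq ha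
  have tprod_ne_zero := tprod_qL_ne_zero hq ha hx
  rw [(multipliable_qL hq x a).tprod_inv₀ tprod_ne_zero,
    ← tsum_evenHermiteTerm_mul_tprod_qL hq hx ha]
  field_simp

end EvenHermite

theorem mainTheorem3 (q ρ x : ℝ) (hq : |q| < 1) (hρ : |ρ| < 1) (hx : x ∈ qSupport q) :
    -- convergence of the infinite products, and non-vanishing of the denominators
    (∀ a : ℝ, Multipliable fun j : ℕ => 1 - a * q ^ j) ∧
    (∀ k : ℕ, qFactorial q k ≠ 0) ∧
    qPochhammerInf ρ q ≠ 0 ∧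
    (∀ k : ℕ, qL q x ρ k ≠ 0) ∧
    (Multipliable fun k : ℕ => qL q x ρ k) ∧
    (Multipliable fun k : ℕ => (qL q x ρ k)⁻¹) ∧
    -- the expansion
    HasSum
      (fun k : ℕ =>
        ρ ^ k * qPochhammerInf (ρ * q ^ (k + 1)) q / qFactorial q k * qHermite q x (2 * k))
      (qPochhammerInf (ρ ^ 2) q / qPochhammerInf ρ q * ∏' k : ℕ, (qL q x ρ k)⁻¹) := by
  refine ⟨multipliable_one_sub_mul_pow hq, qFactorial_ne_zero hq, qPochhammerInf_ne_zero hq hρ,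
    fun k => (qL_pos hq hρ hx k).ne', multipliable_qL hq x ρ,
    (multipliable_qL hq x ρ).inv₀ (tprod_qL_ne_zero hq hρ hx), ?_⟩
  rw [← tsum_evenHermiteTerm hq hx hρ]
  exact (summable_evenHermiteTerm hq hx hρ).hasSum
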